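/- **Setting.** Let $d\ge 1$, let $\mathbb{S}$ be the unit sphere of $\mathbb{C}^d$ and $\sigma$ the normalised surface area measure on $\mathbb{S}$. For $p,q\ge 0$ let $H(p,q)$ be the space of harmonic polynomials on $\mathbb{C}^d$ that are homogeneous of degree $p$ in $z_1,\dots,z_d$ and homogeneous of degree $q$ in $\overline{z_1},\dots,\overline{z_d}$. Let $Q_{00}=1$ and, for $(p,q)\ne(0,0)$, $$Q_{pq}(z)=\frac{p+q+d-1}{(d-1)!}\sum_{j=0}^{\min\{p,q\}}(-1)^j\frac{(d+p+q-j-2)!}{j!\,(p-j)!\,(q-j)!}\,z^{p-j}\,\overline{z}^{\,q-j},\qquad z\in\mathbb{C}.$$ For a set $\tau\subset\mathbb{N}^2$ of indices, a sequence $v_1,\dots,v_n$ of $n\ge1$ points of $\mathbb{S}$ is a $\tau$-*design* if $\int_{\mathbb{S}}P\,d\sigma=\frac1n\sum_{j}P(v_j)$ for all $P\in\sum_{(p,q)\in\tau}H(p,q)$. Its *angles* are the numbers $\langle v_j,v_k\rangle$ with $v_j\ne v_k$. A finite set $X\subset\mathbb{S}$ is a $\tau$-design if a listing of its points without repetition is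 one, and it is an $A$-*code* if all its angles lie in $A$. **Theorem (upper and lower bounds).** Let $F=\sum_{(p,q)}f_{pq}Q_{pq}$ be a finite sum with real coefficients $f_{pq}$ and $f_{00}>0$, let $\tau^+=\{(p,q):f_{pq}>0\}$ and $\tau^-=\{(p,q):f_{pq}<0\}$, and let $A\subset\{z\in\mathbb{C}:|z|\le1,\ z\ne1\}$. Then $F(1)$ is real, and: (i) If $\tau^-=\emptyset$ (that is, $F$ is a potential) and $\operatorname{Re}F(\alpha)\le0$ for all $\alpha\in A$, then the size $n$ of any $A$-code $X$ satisfies $$n\le\frac{F(1)}{f_{00}},$$ with equality if and only if the angles of $X$ are roots of $\operatorname{Re}F$ and $X$ is a $\tau^+$-design. (ii) If $\operatorname{Re}F(\alpha)\ge0$ for all $\alpha\in\mathbb{C}$ with $|\alpha|\le1$, then the number $n$ of points of any $\tau^+$-design (a sequence, possibly with repeated points) satisfies $$n\ge\frac{F(1)}{f_{00}}.$$ For a $\tau^+$-design $X$ without repeated points there is equality if and only if the angles of $X$ are roots of $\operatorname{Re}F$ and $X$ is a $\tau^-$-design. In particular, if $f_{pq}=f_{qp}$ for all $(p,q)$ (so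 that $F$ is real-valued), then in both equality criteria "roots of $\operatorname{Re}F$" may be replaced by "roots of $F$". -/

import Mathlib

noncomputable section

namespace ComplexDesign

/-- The standard Hermitian space `ℂ^d`. -/
abbrev Cd (d : ℕ) : Type := EuclideanSpace ℂ (Fin d)

/-- The unit sphere of `ℂ^d`. -/
abbrev Sph (d : ℕ) : Type := Metric.sphere (0 : Cd d) 1

/-- Polynomials on `ℂ^d` in the variables `z_1, …, z_d` (the indices `Sum.inl i`) and
`conj z_1, …, conj z_d` (the indices `Sum.inr i`). -/
abbrev Poly (d : ℕ) : Type := MvPolynomial (Fin d ⊕ Fin d) ℂ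

/-- The value of a polynomial in `z` and `conj z` at a point `z` of the unit sphere. -/
def evalAt {d : ℕ} (P : Poly d) (z : Sph d) : ℂ :=
  MvPolynomial.eval
    (Sum.elim (fun i => (z : Cd d) i) (fun i => (starRingEnd ℂ) ((z : Cd d) i))) P

/-- A quarter of the Laplacian of `ℂ^d = ℝ^(2d)`, i.e. `∑ i, ∂/∂z_i ∂/∂(conj z_i)`. -/
def laplacian (d : ℕ) : Poly d →ₗ[ℂ] Poly d :=
  ∑ i : Fin d,
    (MvPolynomial.pderiv (R := ℂ) (Sum.inl i : Fin d ⊕ Fin d)).toLinearMap ∘ₗ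
      (MvPolynomial.pderiv (R := ℂ) (Sum.inr i : Fin d ⊕ Fin d)).toLinearMap

/-- `H(p,q)`: the harmonic polynomials that are homogeneous of degree `p` in
`z_1, …, z_d` and homogeneous of degree `q` in `conj z_1, …, conj z_d`. -/
def harmonicSpace (d p q : ℕ) : Submodule ℂ (Poly d) :=
  MvPolynomial.weightedHomogeneousSubmodule ℂ (Sum.elim (fun _ => 1) (fun _ => 0)) p ⊓
    MvPolynomial.weightedHomogeneousSubmodule ℂ (Sum.elim (fun _ => 0) (fun _ => 1)) q ⊓
      LinearMap.ker (laplacian d)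

/-- `P_τ`, the sum of the spaces `H(p,q)` over `(p,q) ∈ τ`. -/
def polySpace (d : ℕ) (τ : Set (ℕ × ℕ)) : Submodule ℂ (Poly d) :=
  ⨆ i ∈ τ, harmonicSpace d i.1 i.2

/-- The surface area measure on the unit sphere of `ℂ^d` (not normalised). -/
def surfaceMeasure (d : ℕ) : MeasureTheory.Measure (Sph d) :=
  (MeasureTheory.volume : MeasureTheory.Measure (Cd d)).toSphere

/-- A (nonempty) sequence of points on the unit sphere of `ℂ^d` is a spherical `τ`-design
if the mean of every `P ∈ P_τ` over the sequence equals the mean of `P` over the sphere,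
i.e. its integral with respect to the normalised surface area measure. -/
def IsDesign {d n : ℕ} (τ : Set (ℕ × ℕ)) (v : Fin n → Sph d) : Prop :=
  0 < n ∧ ∀ P ∈ polySpace d τ,
    ⨍ x, evalAt P x ∂(surfaceMeasure d) = ∑ j, (n : ℂ)⁻¹ * evalAt P (v j)

/-- The set of angles of a sequence of unit vectors: all inner products of two different
vectors (both orders of a pair occur, so the set is closed under conjugation). -/
def angles {d n : ℕ} (v : Fin n → Sph d) : Set ℂ :=
  {α | ∃ j k, v j ≠ v k ∧ α = inner ℂ (v k : Cd d) (v j : Cd d)}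

/-- A set of `n` unit vectors, listed without repetition, is an `A`-code if its angles
belong to `A`. -/
def IsCode {d n : ℕ} (A : Set ℂ) (v : Fin n → Sph d) : Prop :=
  Function.Injective v ∧ angles v ⊆ A

/-- The complex Gegenbauer (disk) polynomial `Q_pq` for `ℂ^d`, `d ≥ 1`. For `p = q = 0` the
general formula gives `1` if `d ≥ 2`, and reads `0 * (-1)!` if `d = 1`, where the value is `1`
as well. In all other cases the natural number subtractions below do not truncate. -/
def gegenbauer (d p q : ℕ) (z : ℂ) : ℂ :=
  if p = 0 ∧ q = 0 then 1 else
    ((p + q + d - 1 : ℕ) : ℂ) / ((d - 1).factorial : ℂ) *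
      ∑ j ∈ Finset.range (min p q + 1),
        (-1) ^ j * ((d + p + q - j - 2).factorial : ℂ) /
          ((j.factorial : ℂ) * ((p - j).factorial : ℂ) * ((q - j).factorial : ℂ)) *
          z ^ (p - j) * (starRingEnd ℂ z) ^ (q - j)

/-- The polynomial `F = ∑ f_pq Q_pq` with finitely many nonzero real coefficients `f_pq`. -/
def gegenbauerSum (d : ℕ) (f : ℕ × ℕ →₀ ℝ) (z : ℂ) : ℂ :=
  f.sum fun i c => (c : ℂ) * gegenbauer d i.1 i.2 z

/-- `τ⁺`, the set of indices of positive coefficients. -/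
def posIndices (f : ℕ × ℕ →₀ ℝ) : Set (ℕ × ℕ) := {i | 0 < f i}

/-- `τ⁻`, the set of indices of negative coefficients. -/
def negIndices (f : ℕ × ℕ →₀ ℝ) : Set (ℕ × ℕ) := {i | f i < 0}

end ComplexDesign

end

/-! Everything rests on evaluating the double sum `∑ j, ∑ k, Re F(⟨v_j, v_k⟩)` in two ways
(`add_offDiagSum_eq`). The diagonal contributes `n F(1)`, the other index pairs contribute `D =
offDiagSum f v`. Expanding `F` in the `Q_pq` instead gives `f_00 n²` from the constant term and a
remainder `E = energyTail f v`. Hence `n (F(1) - f_00 n) = E - D`, and both bounds and their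
equality cases are read off from the signs of `E` and `D`.

The sign of `E` comes from positive definiteness: for `(p,q) ≠ (0,0)` the double sum of `Q_pq` is a
positive multiple of the squared norm of a sum of reproducing kernels of `H(p,q)`
(`sum_gegenbauer_eq`). So it is nonnegative, and it vanishes exactly when every `P ∈ H(p,q)` sums to
zero over the points. The norm is that of the Fischer inner product, for which multiplication by a
variable is adjoint to differentiation. This makes both harmonicity and the reproducing property of
the explicit kernel algebraic identities.

The integral over the sphere enters only through the fact that `H(p,q)` has mean zero for `(p,q) ≠
(0,0)` (`integral_evalAt_eq_zero`), so that the vanishing of those sums is the design condition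
(`isDesign_iff`). This fact is proved for Gaussian moments, where integration by parts applies, and
carried to the sphere by polar coordinates. -/

namespace ComplexDesign

open MvPolynomial

/-! ### The Fischer inner product on polynomials -/

section Fischer

variable {σ : Type*} [Fintype σ]

/-- The product of the factorials of the entries of a multi-index. -/
def multiFactorial (m : σ →₀ ℕ) : ℝ := ∏ s, ((m s).factorial : ℝ)

lemma multiFactorial_pos (m : σ →₀ ℕ) : 0 < multiFactorial m :=
  Finset.prod_pos fun s _ => by exact_mod_cast (m s).factorial_pos

lemma multiFactorial_sub_single (m : σ →₀ ℕ) {s : σ} (hs : m s ≠ 0) :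
    multiFactorial m = m s * multiFactorial (m - Finsupp.single s 1) := by
  classical
  unfold multiFactorial
  have e (g : σ → ℝ) : ∏ t, g t = g s * ∏ t ∈ Finset.univ.erase s, g t :=
    (Finset.mul_prod_erase _ g (Finset.mem_univ s)).symm
  rw [e, e fun t => (((m - Finsupp.single s 1 : σ →₀ ℕ) t).factorial : ℝ), ← mul_assoc]
  congr 1
  · obtain ⟨k, hk⟩ := Nat.exists_eq_succ_of_ne_zero hs
    simp [hk, Nat.factorial_succ]
  · refine Finset.prod_congr rfl fun t ht => ?_
    have : s ≠ t := fun h => by simp [h] at ht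
    simp [this]

/-- The Fischer inner product `⟪P, R⟫ = ∑ m, m! * P_m * conj R_m`, as a linear functional
of `P`. -/
noncomputable def fischer (R : MvPolynomial σ ℂ) : MvPolynomial σ ℂ →ₗ[ℂ] ℂ :=
  (basisMonomials σ ℂ).constr ℂ fun m => (multiFactorial m : ℂ) * starRingEnd ℂ (coeff m R)

lemma fischer_monomial (R : MvPolynomial σ ℂ) (m : σ →₀ ℕ) (c : ℂ) :
    fischer R (monomial m c) = c * ((multiFactorial m : ℂ) * starRingEnd ℂ (coeff m R)) := by
  have h : monomial m c = c • basisMonomials σ ℂ m := by simp [smul_monomial]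
  rw [h, map_smul, fischer, Module.Basis.constr_basis, smul_eq_mul]

omit [Fintype σ] in
lemma linearMap_ext_monomial {M : Type*} [AddCommMonoid M] [Module ℂ M]
    {f g : MvPolynomial σ ℂ →ₗ[ℂ] M}
    (h : ∀ m, f (monomial m 1) = g (monomial m 1)) : f = g :=
  (basisMonomials σ ℂ).ext fun m => by simpa using h m

lemma fischer_add (R₁ R₂ P : MvPolynomial σ ℂ) :
    fischer (R₁ + R₂) P = fischer R₁ P + fischer R₂ P := by
  have : fischer (R₁ + R₂) = fischer R₁ + fischer R₂ :=
    linearMap_ext_monomial fun m => by simp [fischer_monomial, mul_add]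
  rw [this, LinearMap.add_apply]

lemma fischer_C_mul (c : ℂ) (R P : MvPolynomial σ ℂ) :
    fischer (C c * R) P = starRingEnd ℂ c * fischer R P := by
  have : fischer (C c * R) = starRingEnd ℂ c • fischer R :=
    linearMap_ext_monomial fun m => by
      simp only [fischer_monomial, LinearMap.smul_apply, coeff_C_mul, map_mul, smul_eq_mul]; ring
  rw [this, LinearMap.smul_apply, smul_eq_mul]

lemma fischer_zero (P : MvPolynomial σ ℂ) : fischer 0 P = 0 := by
  simpa using fischer_C_mul 0 0 P

lemma fischer_sum {ι : Type*} (s : Finset ι) (R : ι → MvPolynomial σ ℂ) (P : MvPolynomial σ ℂ) :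
    fischer (∑ i ∈ s, R i) P = ∑ i ∈ s, fischer (R i) P := by
  classical
  induction s using Finset.induction_on with
  | empty => simp [fischer_zero]
  | insert a s ha ih => rw [Finset.sum_insert ha, Finset.sum_insert ha, fischer_add, ih]

/-- The weights `m!` are chosen for this: `m! = m s * (m - e_s)!` supplies exactly the factor that
differentiation produces. -/
lemma fischer_X_mul (s : σ) (R P : MvPolynomial σ ℂ) :
    fischer (X s * R) P = fischer R (pderiv s P) := by
  classical
  have : fischer (X s * R) = fischer R ∘ₗ (pderiv (R := ℂ) s : MvPolynomial σ ℂ →ₗ[ℂ] MvPolynomial σ ℂ) := by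
    refine linearMap_ext_monomial fun m => ?_
    simp only [LinearMap.comp_apply, Derivation.coeFn_coe,
      pderiv_monomial, fischer_monomial, coeff_X_mul', Finsupp.mem_support_iff]
    by_cases h : m s = 0
    · simp [h]
    · rw [if_pos h, multiFactorial_sub_single m h]
      push_cast; ring
  rw [this]; rfl

lemma fischer_self (R : MvPolynomial σ ℂ) :
    fischer R R = ((∑ m ∈ R.support, multiFactorial m * ‖coeff m R‖ ^ 2 : ℝ) : ℂ) := by
  conv_lhs => rw [R.as_sum]
  rw [map_sum]
  conv_lhs => rw [← R.as_sum]
  push_cast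
  refine Finset.sum_congr rfl fun m _ => ?_
  rw [fischer_monomial, ← Complex.mul_conj']
  ring

lemma fischer_self_re_nonneg (R : MvPolynomial σ ℂ) : 0 ≤ (fischer R R).re := by
  rw [fischer_self, Complex.ofReal_re]
  exact Finset.sum_nonneg fun m _ => mul_nonneg (multiFactorial_pos m).le (by positivity)

lemma eq_zero_of_fischer_self_re {R : MvPolynomial σ ℂ} (h : (fischer R R).re = 0) : R = 0 := by
  rw [fischer_self, Complex.ofReal_re, Finset.sum_eq_zero_iff_of_nonneg
    fun m _ => mul_nonneg (multiFactorial_pos m).le (by positivity)] at h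
  by_contra hR
  obtain ⟨m, hm⟩ := support_nonempty.mpr hR
  have := h m hm
  have h2 := (multiFactorial_pos m).ne'
  simp [h2] at this
  exact (mem_support_iff.mp hm) this

/-- The linear form with coefficients `conj (a s)`. -/
noncomputable def linForm (a : σ → ℂ) : MvPolynomial σ ℂ := ∑ s, C (starRingEnd ℂ (a s)) * X s

/-- The pairing is conjugate-linear in its first argument, so the conjugated coefficients of
`linForm a` come out as `a s`: the adjoint is the derivative in the direction `a`. -/
lemma fischer_linForm_mul (a : σ → ℂ) (R P : MvPolynomial σ ℂ) :
    fischer (linForm a * R) P = fischer R (∑ s, a s • pderiv s P) := by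
  rw [linForm, Finset.sum_mul, fischer_sum, map_sum]
  refine Finset.sum_congr rfl fun s _ => ?_
  rw [mul_assoc, fischer_C_mul, fischer_X_mul, map_smul, Complex.conj_conj, smul_eq_mul]

/-- Pairing with a power of a linear form evaluates a weighted homogeneous polynomial. -/
lemma exists_fischer_linForm_pow_mul {w w' : σ → ℕ} (hw : ∀ s, w s = 0 ∨ w s = 1)
    (hw' : ∀ s, w s ≠ 0 → w' s = 0) (z : σ → ℂ) (R : MvPolynomial σ ℂ) (q n : ℕ)
    (P : MvPolynomial σ ℂ) (hP : IsWeightedHomogeneous w P n)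
    (hP' : IsWeightedHomogeneous w' P q) :
    ∃ P', fischer (linForm (fun s => w s * z s) ^ n * R) P = fischer R P' ∧
      IsWeightedHomogeneous w P' 0 ∧ IsWeightedHomogeneous w' P' q ∧
      eval z P' = n.factorial * eval z P := by
  induction n generalizing P with
  | zero => exact ⟨P, by simp, hP, hP', by simp⟩
  | succ n ih =>
    -- The directional derivative lowers the `w`-degree by one and keeps the `w'`-degree, because no
    -- variable carries both weights.
    have hD : IsWeightedHomogeneous w (∑ s, (w s * z s : ℂ) • pderiv s P) n := by
      refine IsWeightedHomogeneous.sum _ _ _ fun s _ => ?_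
      rcases hw s with h | h
      · simpa [h] using isWeightedHomogeneous_zero ℂ w n
      · exact Submodule.smul_mem (weightedHomogeneousSubmodule ℂ w n) _ (hP.pderiv (by rw [h]))
    have hD' : IsWeightedHomogeneous w' (∑ s, (w s * z s : ℂ) • pderiv s P) q := by
      refine IsWeightedHomogeneous.sum _ _ _ fun s _ => ?_
      by_cases h : w s = 0
      · simpa [h] using isWeightedHomogeneous_zero ℂ w' q
      · exact Submodule.smul_mem (weightedHomogeneousSubmodule ℂ w' q) _
          (hP'.pderiv (by rw [hw' s h, add_zero]))
    obtain ⟨P', h1, h2, h3, h4⟩ := ih _ hD hD'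
    refine ⟨P', ?_, h2, h3, ?_⟩
    · rw [pow_succ', mul_assoc, fischer_linForm_mul, h1]
    -- Euler's identity at `z`: each directional derivative costs a factor equal to the current
    -- degree, and these factors build up the factorial.
    · have he := congrArg (eval z) hP.sum_weight_X_mul_pderiv
      rw [h4, Nat.factorial_succ]
      simp only [map_sum, nsmul_eq_mul, map_mul, map_natCast, eval_X, smul_eval] at he ⊢
      simp only [mul_assoc, he]
      push_cast; ring

end Fischer

/-! ### Explicit reproducing kernels of the harmonic spaces -/

section Kernel

variable {d : ℕ}

/-- The polynomial `∑ i, z_i * conj z_i`. -/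
noncomputable def normSqPoly (d : ℕ) : Poly d := ∑ i, X (Sum.inl i) * X (Sum.inr i)

/-- The point of `ℂ^(2d)` at which polynomials in `z` and `conj z` are evaluated. -/
noncomputable def doubled (w : Cd d) : Fin d ⊕ Fin d → ℂ :=
  Sum.elim (fun i => w i) (fun i => (starRingEnd ℂ) (w i))

/-- The weight counting the degree in `z`. -/
abbrev weightL (d : ℕ) : Fin d ⊕ Fin d → ℕ := Sum.elim (fun _ => 1) (fun _ => 0)

/-- The weight counting the degree in `conj z`. -/
abbrev weightR (d : ℕ) : Fin d ⊕ Fin d → ℕ := Sum.elim (fun _ => 0) (fun _ => 1)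

/-- The polynomial `z ↦ ⟪w, z⟫`. -/
noncomputable def innerPoly (w : Cd d) : Poly d := ∑ i, C (starRingEnd ℂ (w i)) * X (Sum.inl i)

/-- The polynomial `z ↦ conj ⟪w, z⟫`. -/
noncomputable def conjInnerPoly (w : Cd d) : Poly d := ∑ i, C (w i) * X (Sum.inr i)

lemma innerPoly_eq_linForm (w : Cd d) :
    innerPoly w = linForm (fun s => weightL d s * doubled w s) := by
  simp [innerPoly, linForm, doubled, Fintype.sum_sum_type]

lemma conjInnerPoly_eq_linForm (w : Cd d) :
    conjInnerPoly w = linForm (fun s => weightR d s * doubled w s) := by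
  simp [conjInnerPoly, linForm, doubled, Fintype.sum_sum_type]

lemma laplacian_apply (P : Poly d) :
    laplacian d P = ∑ i, pderiv (Sum.inl i) (pderiv (Sum.inr i) P) := by
  simp [laplacian]

/-- Multiplication by `∑ z_i conj z_i` is adjoint to `∑ ∂/∂z_i ∂/∂(conj z_i)`; therefore harmonic
polynomials are Fischer-orthogonal to all multiples of `normSqPoly d`. -/
lemma fischer_normSqPoly_mul (R P : Poly d) :
    fischer (normSqPoly d * R) P = fischer R (laplacian d P) := by
  rw [normSqPoly, Finset.sum_mul, fischer_sum, laplacian_apply, map_sum]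
  refine Finset.sum_congr rfl fun s _ => ?_
  rw [mul_comm (X _), mul_assoc, fischer_X_mul, fischer_X_mul]

lemma isWeightedHomogeneous_zero_eq_C {P : Poly d} (h1 : IsWeightedHomogeneous (weightL d) P 0)
    (h2 : IsWeightedHomogeneous (weightR d) P 0) : P = C (coeff 0 P) := by
  ext m
  rw [coeff_C]
  split_ifs with h
  · rw [h]
  · by_contra hm
    refine h ?_
    have e1 := h1 hm
    have e2 := h2 hm
    simp [Finsupp.weight_apply, Finsupp.sum_fintype, Fintype.sum_sum_type] at e1 e2
    ext s
    rcases s with s | s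
    · exact (e1 s).symm
    · exact (e2 s).symm

/-- The polynomial `⟪w, z⟫ ^ p * conj ⟪w, z⟫ ^ q / (p! * q!)` reproduces bihomogeneous
polynomials. -/
lemma fischer_innerPoly_pow_mul (w : Cd d) {p q : ℕ} {P : Poly d}
    (h1 : IsWeightedHomogeneous (weightL d) P p) (h2 : IsWeightedHomogeneous (weightR d) P q) :
    fischer (innerPoly w ^ p * conjInnerPoly w ^ q) P =
      p.factorial * q.factorial * eval (doubled w) P := by
  obtain ⟨P₁, e1, e2, e3, e4⟩ := exists_fischer_linForm_pow_mul (w := weightL d) (w' := weightR d)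
    (by rintro (s | s) <;> simp) (by rintro (s | s) <;> simp) (doubled w)
    (conjInnerPoly w ^ q) q p P h1 h2
  obtain ⟨P₂, f1, f2, f3, f4⟩ := exists_fischer_linForm_pow_mul (w := weightR d) (w' := weightL d)
    (by rintro (s | s) <;> simp) (by rintro (s | s) <;> simp) (doubled w)
    1 0 q P₁ e3 e2
  rw [innerPoly_eq_linForm, e1, conjInnerPoly_eq_linForm, ← mul_one (_ ^ q), f1]
  have hC := isWeightedHomogeneous_zero_eq_C f3 f2
  have : fischer 1 P₂ = eval (doubled w) P₂ := by
    rw [hC, eval_C, C_apply, fischer_monomial]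
    simp [multiFactorial]
  rw [this, f4, e4]; ring

/-- Product rule, with `⟪w, z⟫` depending on `z` only and its conjugate on `conj z` only. The mixed
derivative of the two linear factors contributes `∑ |w_i|² = 1`. The truncated exponents are
harmless since their terms carry the factor `j` or `a * b`. -/
lemma laplacian_product {w : Cd d} (hw : ∑ i, w i * starRingEnd ℂ (w i) = 1) (j a b : ℕ) :
    laplacian d (normSqPoly d ^ j * innerPoly w ^ a * conjInnerPoly w ^ b) =
      C (j * (d + j - 1 + a + b) : ℂ) *
        (normSqPoly d ^ (j - 1) * innerPoly w ^ a * conjInnerPoly w ^ b) +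
      C (a * b : ℂ) *
        (normSqPoly d ^ j * innerPoly w ^ (a - 1) * conjInnerPoly w ^ (b - 1)) := by
  have a1 (i) : pderiv (Sum.inl i) (normSqPoly d) = X (Sum.inr i) := by
    simp [normSqPoly, Derivation.leibniz, pderiv_X, Pi.single_apply]
  have a2 (i) : pderiv (Sum.inr i) (normSqPoly d) = X (Sum.inl i) := by
    simp [normSqPoly, Derivation.leibniz, pderiv_X, Pi.single_apply]
  have a3 (i) : pderiv (Sum.inl i) (innerPoly w) = C (starRingEnd ℂ (w i)) := by
    simp [innerPoly, Derivation.leibniz, pderiv_X, Pi.single_apply]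
  have a4 (i) : pderiv (Sum.inr i) (innerPoly w) = 0 := by
    simp [innerPoly, Derivation.leibniz, pderiv_X]
  have a5 (i) : pderiv (Sum.inl i) (conjInnerPoly w) = 0 := by
    simp [conjInnerPoly, Derivation.leibniz, pderiv_X]
  have a6 (i) : pderiv (Sum.inr i) (conjInnerPoly w) = C (w i) := by
    simp [conjInnerPoly, Derivation.leibniz, pderiv_X, Pi.single_apply]
  -- The factor `k` kills the case `k = 0`, in which the truncated exponent is off by one.
  have hpow (x : Poly d) (k : ℕ) : (k : Poly d) * x ^ (k - 1) * x = k * x ^ k := by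
    cases k <;> simp [pow_succ, mul_assoc]
  have hpow2 (x : Poly d) (k : ℕ) :
      (k : Poly d) * (((k - 1 : ℕ) : Poly d) * x ^ (k - 1 - 1) * x) =
        k * ((k : Poly d) - 1) * x ^ (k - 1) := by
    rw [hpow]; cases k <;> simp [mul_assoc]
  set ρ := normSqPoly d with hρ
  set L := innerPoly w with hL
  set M := conjInnerPoly w with hM
  have key (i : Fin d) : pderiv (Sum.inl i) (pderiv (Sum.inr i) (ρ ^ j * L ^ a * M ^ b)) =
      ((j : Poly d) * (((j - 1 : ℕ) : Poly d) * ρ ^ (j - 1 - 1)) * L ^ a * M ^ b) * (X (Sum.inl i) * X (Sum.inr i)) +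
      (j : Poly d) * ρ ^ (j - 1) * L ^ a * M ^ b +
      ((j : Poly d) * ρ ^ (j - 1) * ((a : Poly d) * L ^ (a - 1)) * M ^ b) * (C (starRingEnd ℂ (w i)) * X (Sum.inl i)) +
      ((j : Poly d) * ρ ^ (j - 1) * L ^ a * ((b : Poly d) * M ^ (b - 1))) * (C (w i) * X (Sum.inr i)) +
      (ρ ^ j * ((a : Poly d) * L ^ (a - 1)) * ((b : Poly d) * M ^ (b - 1))) * C (w i * starRingEnd ℂ (w i)) := by
    simp only [Derivation.leibniz, Derivation.leibniz_pow, a1, a2, a3, a4, a5, a6, map_add,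
      smul_eq_mul, nsmul_eq_mul, pderiv_X_self, pderiv_C, Derivation.map_natCast, mul_zero,
      add_zero, zero_add, C_mul]
    ring
  rw [laplacian_apply, Finset.sum_congr rfl fun i _ => key i]
  simp only [Finset.sum_add_distrib, ← Finset.mul_sum]
  rw [← map_sum, hw]
  change _ * ρ + _ + _ * L + _ * M + _ = _
  simp only [Finset.sum_const, Finset.card_univ, Fintype.card_fin, nsmul_eq_mul, map_one, map_mul,
    map_add, map_sub, map_natCast]
  linear_combination (L ^ a * M ^ b) * hpow2 ρ j + (j * ρ ^ (j - 1) * M ^ b) * hpow L a +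
    (j * ρ ^ (j - 1) * L ^ a) * hpow M b

/-- The coefficients of the Gegenbauer polynomial, up to a constant factor. -/
noncomputable def kernelCoeff (d p q j : ℕ) : ℝ :=
  (-1) ^ j * ((d + p + q - j - 2).factorial : ℝ) /
    ((j.factorial : ℝ) * ((p - j).factorial : ℝ) * ((q - j).factorial : ℝ))

/-- The reproducing kernel of `H(p,q)` at `w`, up to a constant factor. -/
noncomputable def kernelPoly (p q : ℕ) (w : Cd d) : Poly d :=
  ∑ j ∈ Finset.range (min p q + 1), C (kernelCoeff d p q j : ℂ) *
    (normSqPoly d ^ j * innerPoly w ^ (p - j) * conjInnerPoly w ^ (q - j))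

/-- This recursion is what makes consecutive terms of the Laplacian of the kernel cancel. -/
lemma kernelCoeff_succ (hd : 1 ≤ d) {p q j : ℕ} (hp : j < p) (hq : j < q) :
    kernelCoeff d p q (j + 1) * ((j + 1) * (d + p + q - j - 2)) +
      kernelCoeff d p q j * ((p - j) * (q - j)) = 0 := by
  obtain ⟨a, rfl⟩ := Nat.exists_eq_add_of_lt hp
  obtain ⟨b, rfl⟩ := Nat.exists_eq_add_of_lt hq
  obtain ⟨e, rfl⟩ := Nat.exists_eq_add_of_le hd
  have e1 : 1 + e + (j + a + 1) + (j + b + 1) - (j + 1) - 2 = e + a + b + j := by omega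
  have e2 : 1 + e + (j + a + 1) + (j + b + 1) - j - 2 = e + a + b + j + 1 := by omega
  have e3 : j + a + 1 - (j + 1) = a := by omega
  have e4 : j + b + 1 - (j + 1) = b := by omega
  have e5 : j + a + 1 - j = a + 1 := by omega
  have e6 : j + b + 1 - j = b + 1 := by omega
  simp only [kernelCoeff, e1, e2, e3, e4, e5, e6, Nat.factorial_succ]
  push_cast
  have := Nat.factorial_ne_zero j
  have := Nat.factorial_ne_zero a
  have := Nat.factorial_ne_zero b
  field_simp
  ring

/-- The sum telescopes: by `laplacian_product` the `j`-th summand yields two terms, and the second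
cancels the first one of summand `j + 1`. At the ends, the first term has the factor `j = 0` and the
last has `(p - j) * (q - j) = 0`. -/
lemma laplacian_kernelPoly (hd : 1 ≤ d) {w : Cd d} (hw : ∑ i, w i * starRingEnd ℂ (w i) = 1)
    (p q : ℕ) : laplacian d (kernelPoly p q w) = 0 := by
  set T : ℕ → Poly d := fun j =>
    normSqPoly d ^ (j - 1) * innerPoly w ^ (p - j) * conjInnerPoly w ^ (q - j) with hT
  set g : ℕ → Poly d := fun j =>
    C (kernelCoeff d p q j * (j * (d + p + q - j - 1)) : ℂ) * T j with hg
  have hterm : ∀ j ∈ Finset.range (min p q + 1),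
      laplacian d (C (kernelCoeff d p q j : ℂ) *
        (normSqPoly d ^ j * innerPoly w ^ (p - j) * conjInnerPoly w ^ (q - j))) =
      g j - if j < min p q then g (j + 1) else 0 := by
    intro j hj
    have hj' : j ≤ min p q := Nat.lt_succ_iff.mp (Finset.mem_range.mp hj)
    have hjp := hj'.trans (min_le_left _ _)
    have hjq := hj'.trans (min_le_right _ _)
    rw [← smul_eq_C_mul, map_smul, laplacian_product hw, smul_eq_C_mul, mul_add,
      ← mul_assoc (C _) (C _), ← mul_assoc (C _) (C _), ← C_mul, ← C_mul, sub_eq_add_neg (g j)]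
    congr 1
    · have hc : (kernelCoeff d p q j : ℂ) *
          (j * (d + j - 1 + ((p - j : ℕ) : ℂ) + ((q - j : ℕ) : ℂ))) =
          kernelCoeff d p q j * (j * (d + p + q - j - 1)) := by
        rw [Nat.cast_sub hjp, Nat.cast_sub hjq]; ring
      rw [hc]
    · split_ifs with h
      · have h1 : j < p := h.trans_le (min_le_left _ _)
        have h2 : j < q := h.trans_le (min_le_right _ _)
        have := kernelCoeff_succ hd h1 h2
        have hc : (kernelCoeff d p q j : ℂ) * (((p - j : ℕ) : ℂ) * ((q - j : ℕ) : ℂ)) =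
            -((kernelCoeff d p q (j + 1) : ℂ) *
              (((j + 1 : ℕ) : ℂ) * (d + p + q - ((j + 1 : ℕ) : ℂ) - 1))) := by
          have h3 : ((kernelCoeff d p q (j + 1) * ((j + 1) * (d + p + q - j - 2)) +
            kernelCoeff d p q j * ((p - j) * (q - j)) : ℝ) : ℂ) = 0 := by rw [this]; simp
          rw [Nat.cast_sub hjp, Nat.cast_sub hjq]
          push_cast at h3 ⊢
          linear_combination h3
        rw [hc, C_neg, neg_mul]
        simp only [hg, hT, Nat.add_sub_cancel, Nat.sub_sub]
      · have : p - j = 0 ∨ q - j = 0 := by omega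
        rcases this with h | h <;> simp [h]
  rw [kernelPoly, map_sum, Finset.sum_congr rfl hterm, Finset.sum_sub_distrib,
    Finset.sum_range_succ', Finset.sum_range_succ _ (min p q)]
  rw [Finset.sum_congr rfl fun j hj => if_pos (Finset.mem_range.mp hj)]
  simp [hg]

lemma kernelPoly_isWeightedHomogeneous_left (p q : ℕ) (w : Cd d) :
    IsWeightedHomogeneous (weightL d) (kernelPoly p q w) p := by
  refine IsWeightedHomogeneous.sum _ _ _ fun j hj => ?_
  have hj' : j ≤ p := (Nat.lt_succ_iff.mp (Finset.mem_range.mp hj)).trans (min_le_left _ _)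
  have h1 : IsWeightedHomogeneous (weightL d) (normSqPoly d) 1 :=
    IsWeightedHomogeneous.sum _ _ _ fun i _ =>
      (isWeightedHomogeneous_X ℂ (weightL d) (Sum.inl i)).mul
        (isWeightedHomogeneous_X ℂ (weightL d) (Sum.inr i))
  have h2 : IsWeightedHomogeneous (weightL d) (innerPoly w) 1 :=
    IsWeightedHomogeneous.sum _ _ _ fun i _ => by
      simpa using (isWeightedHomogeneous_C (weightL d) (starRingEnd ℂ (w i))).mul
        (isWeightedHomogeneous_X ℂ (weightL d) (Sum.inl i))
  have h3 : IsWeightedHomogeneous (weightL d) (conjInnerPoly w) 0 :=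
    IsWeightedHomogeneous.sum _ _ _ fun i _ => by
      simpa using (isWeightedHomogeneous_C (weightL d) (w i)).mul
        (isWeightedHomogeneous_X ℂ (weightL d) (Sum.inr i))
  have := (isWeightedHomogeneous_C (weightL d) (kernelCoeff d p q j : ℂ)).mul
    (((h1.pow j).mul (h2.pow (p - j))).mul (h3.pow (q - j)))
  simpa [hj'] using this

lemma kernelPoly_isWeightedHomogeneous_right (p q : ℕ) (w : Cd d) :
    IsWeightedHomogeneous (weightR d) (kernelPoly p q w) q := by
  refine IsWeightedHomogeneous.sum _ _ _ fun j hj => ?_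
  have hj' : j ≤ q := (Nat.lt_succ_iff.mp (Finset.mem_range.mp hj)).trans (min_le_right _ _)
  have h1 : IsWeightedHomogeneous (weightR d) (normSqPoly d) 1 :=
    IsWeightedHomogeneous.sum _ _ _ fun i _ =>
      (isWeightedHomogeneous_X ℂ (weightR d) (Sum.inl i)).mul
        (isWeightedHomogeneous_X ℂ (weightR d) (Sum.inr i))
  have h2 : IsWeightedHomogeneous (weightR d) (innerPoly w) 0 :=
    IsWeightedHomogeneous.sum _ _ _ fun i _ => by
      simpa using (isWeightedHomogeneous_C (weightR d) (starRingEnd ℂ (w i))).mul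
        (isWeightedHomogeneous_X ℂ (weightR d) (Sum.inl i))
  have h3 : IsWeightedHomogeneous (weightR d) (conjInnerPoly w) 1 :=
    IsWeightedHomogeneous.sum _ _ _ fun i _ => by
      simpa using (isWeightedHomogeneous_C (weightR d) (w i)).mul
        (isWeightedHomogeneous_X ℂ (weightR d) (Sum.inr i))
  have := (isWeightedHomogeneous_C (weightR d) (kernelCoeff d p q j : ℂ)).mul
    (((h1.pow j).mul (h2.pow (p - j))).mul (h3.pow (q - j)))
  simpa [hj'] using this

lemma mem_harmonicSpace {p q : ℕ} {P : Poly d} : P ∈ harmonicSpace d p q ↔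
    IsWeightedHomogeneous (weightL d) P p ∧ IsWeightedHomogeneous (weightR d) P q ∧
      laplacian d P = 0 := by
  rw [harmonicSpace, Submodule.mem_inf, Submodule.mem_inf, mem_weightedHomogeneousSubmodule,
    mem_weightedHomogeneousSubmodule, LinearMap.mem_ker, and_assoc]

lemma kernelPoly_mem_harmonicSpace (hd : 1 ≤ d) {w : Cd d}
    (hw : ∑ i, w i * starRingEnd ℂ (w i) = 1) (p q : ℕ) :
    kernelPoly p q w ∈ harmonicSpace d p q :=
  mem_harmonicSpace.mpr ⟨kernelPoly_isWeightedHomogeneous_left p q w,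
    kernelPoly_isWeightedHomogeneous_right p q w, laplacian_kernelPoly hd hw p q⟩

/-- The reproducing property of the kernel of `H(p,q)`. -/
lemma fischer_kernelPoly {p q : ℕ} (w : Cd d) {P : Poly d} (hP : P ∈ harmonicSpace d p q) :
    fischer (kernelPoly p q w) P = ((d + p + q - 2).factorial : ℂ) * eval (doubled w) P := by
  obtain ⟨h1, h2, h3⟩ := mem_harmonicSpace.mp hP
  -- Summands with a factor `normSqPoly d` pair to zero with the harmonic `P`; only `j = 0`
  -- survives.
  rw [kernelPoly, fischer_sum, Finset.sum_range_succ', Finset.sum_eq_zero]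
  · rw [fischer_C_mul, pow_zero, one_mul, Nat.sub_zero, Nat.sub_zero,
      fischer_innerPoly_pow_mul w h1 h2, kernelCoeff]
    have := Nat.factorial_ne_zero p
    have := Nat.factorial_ne_zero q
    simp
    field_simp
  · intro j _
    rw [fischer_C_mul, pow_succ', mul_assoc, mul_assoc, fischer_normSqPoly_mul, h3, map_zero,
      mul_zero]

end Kernel

end ComplexDesign

namespace ComplexDesign

open MvPolynomial MeasureTheory

/-! ### Gaussian moments of harmonic polynomials -/

section Moment

variable {d : ℕ}

open Classical in
/-- The moments of the standard Gaussian measure on `ℂ^d`, as a linear functional. -/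
noncomputable def gaussianMoment (d : ℕ) : Poly d →ₗ[ℂ] ℂ :=
  (basisMonomials _ ℂ).constr ℂ fun m =>
    if ∀ i : Fin d, m (Sum.inl i) = m (Sum.inr i) then
      ∏ i : Fin d, ((m (Sum.inl i)).factorial : ℂ) else 0

open Classical in
lemma gaussianMoment_monomial (m : Fin d ⊕ Fin d →₀ ℕ) (c : ℂ) :
    gaussianMoment d (monomial m c) = c * if ∀ i : Fin d, m (Sum.inl i) = m (Sum.inr i) then
      ∏ i : Fin d, ((m (Sum.inl i)).factorial : ℂ) else 0 := by
  have h : monomial m c = c • basisMonomials (Fin d ⊕ Fin d) ℂ m := by simp [smul_monomial]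
  rw [h, map_smul, gaussianMoment, Module.Basis.constr_basis, smul_eq_mul]

/-- Gaussian integration by parts, in algebraic form: if all exponents match, it is `k * k * (k -
1)! = k * k!` in the `i`-th factor; otherwise both sides vanish. -/
lemma gaussianMoment_pderiv_pderiv (m : Fin d ⊕ Fin d →₀ ℕ) (c : ℂ) (i : Fin d) :
    gaussianMoment d (pderiv (Sum.inl i) (pderiv (Sum.inr i) (monomial m c))) =
      m (Sum.inl i) * gaussianMoment d (monomial m c) := by
  classical
  rw [pderiv_monomial, pderiv_monomial]
  set m' := m - Finsupp.single (Sum.inr i) 1 - Finsupp.single (Sum.inl i) 1 with hm'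
  have hl (k) : m' (Sum.inl k) = m (Sum.inl k) - if i = k then 1 else 0 := by
    simp [hm', Finsupp.single_apply]
  have hr (k) : m' (Sum.inr k) = m (Sum.inr k) - if i = k then 1 else 0 := by
    simp [hm', Finsupp.single_apply]
  have hi : (m - Finsupp.single (Sum.inr i) 1 : Fin d ⊕ Fin d →₀ ℕ) (Sum.inl i) =
    m (Sum.inl i) := by simp
  rw [gaussianMoment_monomial, gaussianMoment_monomial, hi]
  -- Zero exponents are treated apart, since truncated subtraction would break the equivalence
  -- `hiff`.
  by_cases h0 : m (Sum.inl i) = 0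
  · simp [h0]
  by_cases h1 : m (Sum.inr i) = 0
  · have : ¬ ∀ k, m (Sum.inl k) = m (Sum.inr k) := fun h => h0 ((h i).trans h1)
    simp [h1, this]
  have hiff : (∀ k, m' (Sum.inl k) = m' (Sum.inr k)) ↔ ∀ k, m (Sum.inl k) = m (Sum.inr k) := by
    refine forall_congr' fun k => ?_
    rw [hl, hr]
    by_cases hk : i = k
    · subst hk; simp only [if_true]; omega
    · simp [hk]
  by_cases h : ∀ k, m (Sum.inl k) = m (Sum.inr k)
  · rw [if_pos h, if_pos (hiff.mpr h)]
    have e (g : Fin d → ℂ) : ∏ t, g t = g i * ∏ t ∈ Finset.univ.erase i, g t :=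
      (Finset.mul_prod_erase _ g (Finset.mem_univ i)).symm
    rw [e, e fun k => ((m (Sum.inl k)).factorial : ℂ)]
    have hprod : ∏ k ∈ Finset.univ.erase i, ((m' (Sum.inl k)).factorial : ℂ) =
        ∏ k ∈ Finset.univ.erase i, ((m (Sum.inl k)).factorial : ℂ) := by
      refine Finset.prod_congr rfl fun k hk => ?_
      have : i ≠ k := fun h => by simp [h] at hk
      simp [hl, this]
    obtain ⟨k, hk⟩ := Nat.exists_eq_succ_of_ne_zero h0
    rw [hprod, ← h i, hl, if_pos rfl, hk, Nat.succ_sub_one, Nat.factorial_succ]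
    push_cast
    ring
  · rw [if_neg h, if_neg fun h' => h (hiff.mp h')]
    simp

lemma gaussianMoment_laplacian_monomial (m : Fin d ⊕ Fin d →₀ ℕ) (c : ℂ) :
    gaussianMoment d (laplacian d (monomial m c)) =
      (∑ i, m (Sum.inl i) : ℕ) * gaussianMoment d (monomial m c) := by
  rw [laplacian_apply, map_sum, Finset.sum_congr rfl fun i _ => gaussianMoment_pderiv_pderiv m c i,
    ← Finset.sum_mul]
  push_cast; rfl

/-- A monomial with nonzero moment has equal degrees in `z` and `conj z`. -/
lemma gaussianMoment_laplacian_monomial' (m : Fin d ⊕ Fin d →₀ ℕ) (c : ℂ) :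
    gaussianMoment d (laplacian d (monomial m c)) =
      (∑ i, m (Sum.inr i) : ℕ) * gaussianMoment d (monomial m c) := by
  classical
  rw [gaussianMoment_laplacian_monomial, gaussianMoment_monomial]
  split_ifs with h
  · simp [h]
  · simp

lemma weightL_apply (m : Fin d ⊕ Fin d →₀ ℕ) :
    Finsupp.weight (weightL d) m = ∑ i, m (Sum.inl i) := by
  simp [Finsupp.weight_apply, Finsupp.sum_fintype, Fintype.sum_sum_type]

lemma weightR_apply (m : Fin d ⊕ Fin d →₀ ℕ) :
    Finsupp.weight (weightR d) m = ∑ i, m (Sum.inr i) := by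
  simp [Finsupp.weight_apply, Finsupp.sum_fintype, Fintype.sum_sum_type]

/-- Harmonic polynomials of positive degree have mean zero for the Gaussian measure. -/
lemma gaussianMoment_eq_zero {p q : ℕ} (h : (p, q) ≠ (0, 0)) {P : Poly d}
    (hP : P ∈ harmonicSpace d p q) : gaussianMoment d P = 0 := by
  obtain ⟨h1, h2, h3⟩ := mem_harmonicSpace.mp hP
  -- On each monomial of `P` the Laplacian multiplies the moment by the degree `p`, while the
  -- Laplacian of `P` is zero.
  have hp : (p : ℂ) * gaussianMoment d P = 0 := by
    rw [← map_zero (gaussianMoment d), ← h3, P.as_sum, map_sum, map_sum, map_sum, Finset.mul_sum]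
    refine Finset.sum_congr rfl fun m hm => ?_
    rw [gaussianMoment_laplacian_monomial, ← weightL_apply, h1 (mem_support_iff.mp hm)]
  have hq : (q : ℂ) * gaussianMoment d P = 0 := by
    rw [← map_zero (gaussianMoment d), ← h3, P.as_sum, map_sum, map_sum, map_sum, Finset.mul_sum]
    refine Finset.sum_congr rfl fun m hm => ?_
    rw [gaussianMoment_laplacian_monomial', ← weightR_apply, h2 (mem_support_iff.mp hm)]
  by_contra hne
  exact h (by simpa [hne] using And.intro hp hq)

end Moment

/-! ### From Gaussian integrals to integrals over the sphere -/

section Integral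

variable {d : ℕ}

lemma integral_pow_mul_conj_pow_mul_exp (a b : ℕ) :
    ∫ z : ℂ, z ^ a * starRingEnd ℂ z ^ b * (Real.exp (-‖z‖ ^ 2) : ℂ) =
      if a = b then (Real.pi : ℂ) * a.factorial else 0 := by
  split_ifs with h
  · subst h
    have h1 := Complex.integral_rpow_mul_exp_neg_rpow (p := 2) (q := 2 * a) (by norm_num)
      (by have : (0 : ℝ) ≤ a := Nat.cast_nonneg a
          linarith)
    have h2 : ((2 * a + 2) / 2 : ℝ) = a + 1 := by ring
    rw [h2, Real.Gamma_nat_eq_factorial] at h1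
    have h3 : (2 * Real.pi / 2 * (a.factorial : ℝ)) = Real.pi * a.factorial := by ring
    rw [h3] at h1
    rw [← Complex.ofReal_natCast, ← Complex.ofReal_mul, ← h1, ← integral_complex_ofReal]
    congr 1 with z
    rw [← mul_pow, Complex.mul_conj']
    have : (‖z‖ : ℝ) ^ (2 * (a : ℝ)) = (‖z‖ ^ 2) ^ a := by
      rw [← pow_mul]; exact_mod_cast Real.rpow_natCast ‖z‖ (2 * a)
    rw [this]
    norm_num
  · have hab : ((a : ℝ) - b) ≠ 0 := sub_ne_zero.mpr (by exact_mod_cast h)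
    -- The angle makes `u ^ a * conj u ^ b = exp (π i) = -1`, so the rotation by `u` preserves the
    -- integral and also changes its sign.
    set u : Circle := Circle.exp (Real.pi / (a - b)) with hu
    have hu1 : (u : ℂ) ^ a * starRingEnd ℂ (u : ℂ) ^ b = -1 := by
      rw [hu, ← Circle.coe_inv_eq_conj, ← Circle.exp_neg, Circle.coe_exp, Circle.coe_exp,
        ← Complex.exp_nat_mul, ← Complex.exp_nat_mul, ← Complex.exp_add, ← Complex.exp_pi_mul_I]
      congr 1
      have : ((a : ℂ) - b) ≠ 0 := by exact_mod_cast hab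
      push_cast
      field_simp
      ring
    have hrot := (LinearIsometryEquiv.measurePreserving (rotation u)).integral_comp
      (rotation u).toHomeomorph.measurableEmbedding
      (fun z : ℂ => z ^ a * starRingEnd ℂ z ^ b * (Real.exp (-‖z‖ ^ 2) : ℂ))
    have hneg : ∀ z : ℂ, (rotation u z) ^ a * starRingEnd ℂ (rotation u z) ^ b *
        (Real.exp (-‖rotation u z‖ ^ 2) : ℂ) =
        -(z ^ a * starRingEnd ℂ z ^ b * (Real.exp (-‖z‖ ^ 2) : ℂ)) := by
      intro z
      rw [LinearIsometryEquiv.norm_map, rotation_apply, map_mul, mul_pow, mul_pow]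
      linear_combination (z ^ a * starRingEnd ℂ z ^ b * (Real.exp (-‖z‖ ^ 2) : ℂ)) * hu1
    simp only [hneg, integral_neg] at hrot
    exact self_eq_neg.mp hrot.symm

lemma eval_doubled_monomial (m : Fin d ⊕ Fin d →₀ ℕ) (z : Cd d) :
    eval (doubled z) (monomial m 1) =
      ∏ i, (z i ^ m (Sum.inl i) * starRingEnd ℂ (z i) ^ m (Sum.inr i)) := by
  rw [eval_monomial, one_mul, Finsupp.prod_fintype _ _ (by simp), Fintype.prod_sum_type,
    ← Finset.prod_mul_distrib]
  simp [doubled]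

/-- The Gaussian integrals of monomials are proportional to the Gaussian moments. -/
lemma exists_integral_monomial_mul_exp (d : ℕ) : ∃ c : ℂ, ∀ m : Fin d ⊕ Fin d →₀ ℕ,
    ∫ z : Cd d, eval (doubled z) (monomial m 1) * (Real.exp (-‖z‖ ^ 2) : ℂ) =
      c * gaussianMoment d (monomial m 1) := by
  classical
  let e : (Fin d → ℂ) ≃L[ℝ] Cd d :=
    (PiLp.continuousLinearEquiv 2 ℝ (fun _ : Fin d => ℂ)).symm
  have hemb : MeasurableEmbedding e := e.toHomeomorph.measurableEmbedding
  -- Uniqueness of Haar measure relates the Euclidean volume to the product volume; the constant is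
  -- irrelevant, as only vanishing moments are used later.
  have : (Measure.map e (volume : Measure (Fin d → ℂ))).IsAddHaarMeasure :=
    e.isAddHaarMeasure_map _
  obtain ⟨c, hc⟩ : ∃ c : NNReal, (volume : Measure (Cd d)) = c • Measure.map e volume :=
    ⟨_, Measure.isAddLeftInvariant_eq_smul _ _⟩
  refine ⟨c * (Real.pi : ℂ) ^ d, fun m => ?_⟩
  rw [hc, integral_smul_nnreal_measure, hemb.integral_map]
  have hint (x : Fin d → ℂ) :
      eval (doubled (e x)) (monomial m 1) * (Real.exp (-‖e x‖ ^ 2) : ℂ) =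
      ∏ i, (x i ^ m (Sum.inl i) * starRingEnd ℂ (x i) ^ m (Sum.inr i) *
        (Real.exp (-‖x i‖ ^ 2) : ℂ)) := by
    rw [eval_doubled_monomial, EuclideanSpace.norm_sq_eq, ← Finset.sum_neg_distrib, Real.exp_sum,
      Complex.ofReal_prod, ← Finset.prod_mul_distrib]
    rfl
  change c • ∫ x : Fin d → ℂ,
    eval (doubled (e x)) (monomial m 1) * (Real.exp (-‖e x‖ ^ 2) : ℂ) = _
  simp_rw [hint]
  rw [integral_fintype_prod_volume_eq_prod (fun (i : Fin d) (z : ℂ) =>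
    z ^ m (Sum.inl i) * starRingEnd ℂ z ^ m (Sum.inr i) * (Real.exp (-‖z‖ ^ 2) : ℂ))]
  simp_rw [integral_pow_mul_conj_pow_mul_exp]
  rw [gaussianMoment_monomial, one_mul, NNReal.smul_def, Complex.real_smul, mul_assoc]
  congr 1
  split_ifs with h
  · simp [h, Finset.prod_mul_distrib]
  · push Not at h
    obtain ⟨i, hi⟩ := h
    rw [mul_zero]
    exact Finset.prod_eq_zero (Finset.mem_univ i) (if_neg hi)

/-- This is the radial factor in polar coordinates, a positive Gamma value; it must be nonzero to be
divided out. -/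
lemma integral_volumeIoiPow_pow_mul_exp_ne_zero (N k : ℕ) :
    ∫ r : Set.Ioi (0 : ℝ), (((r : ℝ) ^ k * Real.exp (-(r : ℝ) ^ 2) : ℝ) : ℂ)
      ∂(Measure.volumeIoiPow N) ≠ 0 := by
  rw [integral_complex_ofReal, Complex.ofReal_ne_zero]
  have h : ∫ r : Set.Ioi (0 : ℝ), ((r : ℝ) ^ k * Real.exp (-(r : ℝ) ^ 2))
      ∂(Measure.volumeIoiPow N) =
      ∫ r in Set.Ioi (0 : ℝ), r ^ ((N + k : ℕ) : ℝ) * Real.exp (-r ^ (2 : ℝ)) := by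
    simp only [Measure.volumeIoiPow, ENNReal.ofReal]
    rw [integral_withDensity_eq_integral_smul,
      integral_subtype_comap measurableSet_Ioi
        fun a : ℝ => Real.toNNReal (a ^ N) • (a ^ k * Real.exp (-a ^ 2)),
      setIntegral_congr_fun measurableSet_Ioi fun x hx => ?_]
    · rw [NNReal.smul_def, Real.coe_toNNReal _ (pow_nonneg (le_of_lt hx) _), smul_eq_mul,
        Real.rpow_natCast, pow_add, mul_assoc]
      norm_num
    · exact (measurable_subtype_coe.pow_const _).real_toNNReal
  rw [h, integral_rpow_mul_exp_neg_rpow (by norm_num)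
    (by have : (0 : ℝ) ≤ ((N + k : ℕ) : ℝ) := Nat.cast_nonneg _
        linarith)]
  have : 0 < Real.Gamma ((((N + k : ℕ) : ℝ) + 1) / 2) := Real.Gamma_pos_of_pos (by positivity)
  positivity

lemma eval_doubled_smul_monomial (m : Fin d ⊕ Fin d →₀ ℕ) (r : ℝ) (z : Cd d) :
    eval (doubled (r • z)) (monomial m 1) =
      (r : ℂ) ^ (∑ s, m s) * eval (doubled z) (monomial m 1) := by
  rw [eval_doubled_monomial, eval_doubled_monomial, Fintype.sum_sum_type, ← Finset.sum_add_distrib,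
    ← Finset.prod_pow_eq_pow_sum, ← Finset.prod_mul_distrib]
  refine Finset.prod_congr rfl fun i _ => ?_
  simp only [PiLp.smul_apply, Complex.real_smul, map_mul, Complex.conj_ofReal]
  ring

lemma nontrivial_Cd (hd : 1 ≤ d) : Nontrivial (Cd d) := by
  have : Nonempty (Fin d) := ⟨⟨0, hd⟩⟩
  infer_instance

instance : IsFiniteMeasure (surfaceMeasure d) := by unfold surfaceMeasure; infer_instance

/-- Gaussian integrals of monomials in polar coordinates. -/
lemma integral_monomial_mul_exp_eq (hd : 1 ≤ d) (m : Fin d ⊕ Fin d →₀ ℕ) :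
    ∫ z : Cd d, eval (doubled z) (monomial m 1) * (Real.exp (-‖z‖ ^ 2) : ℂ) =
      (∫ x, evalAt (monomial m 1) x ∂(surfaceMeasure d)) *
        ∫ r : Set.Ioi (0 : ℝ), (((r : ℝ) ^ (∑ s, m s) * Real.exp (-(r : ℝ) ^ 2) : ℝ) : ℂ)
          ∂(Measure.volumeIoiPow (Module.finrank ℝ (Cd d) - 1)) := by
  have := nontrivial_Cd hd
  set F : Cd d → ℂ := fun z => eval (doubled z) (monomial m 1) * (Real.exp (-‖z‖ ^ 2) : ℂ) with hF
  have h1 : ∫ z, F z = ∫ z : ({(0)}ᶜ : Set (Cd d)), F z ∂(Measure.comap Subtype.val volume) := by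
    rw [integral_subtype_comap (measurableSet_singleton _).compl F, restrict_compl_singleton]
  have h2 := (Measure.measurePreserving_homeomorphUnitSphereProd
    (volume : Measure (Cd d))).symm (homeomorphUnitSphereProd (Cd d)).toMeasurableEquiv
  have h3 := h2.integral_comp (MeasurableEquiv.measurableEmbedding _)
    (fun z : ({(0)}ᶜ : Set (Cd d)) => F z)
  rw [h1, ← h3, ← integral_prod_mul]
  refine integral_congr_ae (Filter.Eventually.of_forall ?_)
  rintro ⟨x, r⟩
  have hx : ‖(x : Cd d)‖ = 1 := by simp
  have hr : (0 : ℝ) < r := r.2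
  have hv : (((homeomorphUnitSphereProd (Cd d)).toMeasurableEquiv.symm (x, r) :
      ({(0)}ᶜ : Set (Cd d))) : Cd d) = (r : ℝ) • (x : Cd d) := rfl
  change F _ = _
  rw [hv, hF]
  simp only [eval_doubled_smul_monomial, norm_smul, hx, mul_one, Real.norm_eq_abs, abs_of_pos hr]
  change _ = eval (doubled (x : Cd d)) (monomial m 1) * _
  push_cast
  ring

lemma continuous_evalAt (P : Poly d) : Continuous (evalAt P) := by
  have : Continuous fun z : Sph d => doubled (z : Cd d) := by
    refine continuous_pi fun s => ?_
    rcases s with i | i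
    · simp only [doubled, Sum.elim_inl]; fun_prop
    · simp only [doubled, Sum.elim_inr]; fun_prop
  exact P.continuous_eval.comp this

lemma integrable_evalAt (P : Poly d) : Integrable (evalAt P) (surfaceMeasure d) :=
  (continuous_evalAt P).integrable_of_hasCompactSupport (HasCompactSupport.of_compactSpace _)

lemma evalAt_add (P R : Poly d) (z : Sph d) : evalAt (P + R) z = evalAt P z + evalAt R z :=
  map_add _ _ _

lemma evalAt_sum {ι : Type*} (s : Finset ι) (P : ι → Poly d) (z : Sph d) :
    evalAt (∑ i ∈ s, P i) z = ∑ i ∈ s, evalAt (P i) z := map_sum _ _ _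

lemma evalAt_monomial (m : Fin d ⊕ Fin d →₀ ℕ) (c : ℂ) (z : Sph d) :
    evalAt (monomial m c) z = c * evalAt (monomial m 1) z := by
  simp [evalAt, eval_monomial]

/-- The surface integral of a homogeneous polynomial is proportional to its Gaussian moment. -/
lemma exists_integral_evalAt_eq (hd : 1 ≤ d) (k : ℕ) : ∃ c : ℂ, ∀ P : Poly d,
    (∀ m ∈ P.support, ∑ s, m s = k) →
      ∫ x, evalAt P x ∂(surfaceMeasure d) = c * gaussianMoment d P := by
  obtain ⟨c, hc⟩ := exists_integral_monomial_mul_exp d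
  have hI := integral_volumeIoiPow_pow_mul_exp_ne_zero (Module.finrank ℝ (Cd d) - 1) k
  set I := ∫ r : Set.Ioi (0 : ℝ), (((r : ℝ) ^ k * Real.exp (-(r : ℝ) ^ 2) : ℝ) : ℂ)
      ∂(Measure.volumeIoiPow (Module.finrank ℝ (Cd d) - 1)) with hIdef
  -- The radial integral `I` depends on a monomial only through its degree `k`, so one constant
  -- serves all of them.
  refine ⟨c / I, fun P hP => ?_⟩
  have h1 : ∀ m ∈ P.support, ∫ x, evalAt (monomial m (coeff m P)) x ∂(surfaceMeasure d) =
      c / I * gaussianMoment d (monomial m (coeff m P)) := by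
    intro m hm
    have h2 := integral_monomial_mul_exp_eq hd m
    rw [hc, hP m hm, ← hIdef] at h2
    have h3 : gaussianMoment d (monomial m (coeff m P)) =
        coeff m P * gaussianMoment d (monomial m 1) := by
      rw [← smul_eq_mul, ← map_smul, smul_monomial, smul_eq_mul, mul_one]
    simp_rw [evalAt_monomial m (coeff m P)]
    rw [integral_const_mul, h3]
    field_simp
    linear_combination (-coeff m P) * h2
  conv_lhs => rw [P.as_sum]
  conv_rhs => rw [P.as_sum]
  simp_rw [evalAt_sum]
  rw [integral_finsetSum _ fun m _ => integrable_evalAt _, map_sum, Finset.mul_sum]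
  exact Finset.sum_congr rfl h1

/-- Harmonic polynomials of positive degree have mean zero on the sphere. -/
lemma integral_evalAt_eq_zero (hd : 1 ≤ d) {p q : ℕ} (h : (p, q) ≠ (0, 0)) {P : Poly d}
    (hP : P ∈ harmonicSpace d p q) : ∫ x, evalAt P x ∂(surfaceMeasure d) = 0 := by
  obtain ⟨c, hc⟩ := exists_integral_evalAt_eq hd (p + q)
  obtain ⟨h1, h2, h3⟩ := mem_harmonicSpace.mp hP
  rw [hc P, gaussianMoment_eq_zero h hP, mul_zero]
  intro m hm
  have e1 := h1 (mem_support_iff.mp hm)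
  have e2 := h2 (mem_support_iff.mp hm)
  rw [weightL_apply] at e1
  rw [weightR_apply] at e2
  rw [Fintype.sum_sum_type, e1, e2]

end Integral

end ComplexDesign

namespace ComplexDesign

open MvPolynomial MeasureTheory

/-! ### Positive definiteness of Gegenbauer polynomials and the design condition -/

section Design

variable {d n : ℕ}

lemma sum_mul_conj_eq_one (w : Sph d) :
    ∑ i, (w : Cd d) i * starRingEnd ℂ ((w : Cd d) i) = 1 := by
  have h : ‖(w : Cd d)‖ ^ 2 = 1 := by simp
  rw [EuclideanSpace.norm_sq_eq] at h
  simp_rw [Complex.mul_conj']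
  exact_mod_cast h

/-- On the sphere the powers of `normSqPoly d` become `1`, which leaves a polynomial in `⟪w, z⟫` and
its conjugate. -/
lemma gegenbauer_inner {p q : ℕ} (h : (p, q) ≠ (0, 0)) (w z : Sph d) :
    gegenbauer d p q (inner ℂ (w : Cd d) (z : Cd d)) =
      ((p + q + d - 1 : ℕ) : ℂ) / ((d - 1).factorial : ℂ) *
        evalAt (kernelPoly p q (w : Cd d)) z := by
  have h' : ¬ (p = 0 ∧ q = 0) := fun h' => h (by rw [h'.1, h'.2])
  have e1 : eval (doubled (z : Cd d)) (normSqPoly d) = 1 := by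
    rw [← sum_mul_conj_eq_one z]; simp [normSqPoly, doubled]
  have e2 : eval (doubled (z : Cd d)) (innerPoly (w : Cd d)) = inner ℂ (w : Cd d) (z : Cd d) := by
    simp [innerPoly, doubled, PiLp.inner_apply, mul_comm]
  have e3 : eval (doubled (z : Cd d)) (conjInnerPoly (w : Cd d)) =
      starRingEnd ℂ (inner ℂ (w : Cd d) (z : Cd d)) := by
    simp [conjInnerPoly, doubled, PiLp.inner_apply, mul_comm]
  rw [gegenbauer, if_neg h']
  congr 1
  change _ = eval (doubled (z : Cd d)) _
  rw [kernelPoly, map_sum]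
  refine Finset.sum_congr rfl fun j _ => ?_
  simp only [map_mul, map_pow, e1, e2, e3, eval_C, one_pow, one_mul, kernelCoeff]
  push_cast
  ring

/-- The double sum of a Gegenbauer polynomial over a sequence is a positive multiple of the
squared norm of the sum of the reproducing kernels. -/
lemma sum_gegenbauer_eq (hd : 1 ≤ d) {p q : ℕ} (h : (p, q) ≠ (0, 0)) (v : Fin n → Sph d) :
    ∃ c : ℝ, 0 < c ∧
      ∑ j, ∑ k, gegenbauer d p q (inner ℂ (v k : Cd d) (v j : Cd d)) =
        c * fischer (∑ k, kernelPoly p q (v k : Cd d)) (∑ k, kernelPoly p q (v k : Cd d)) := by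
  have hpq : 0 < p + q + d - 1 := by
    have : p ≠ 0 ∨ q ≠ 0 := by
      by_contra! h'
      exact h (by rw [h'.1, h'.2])
    omega
  -- The normalisation of `Q_pq` divided by the constant of `fischer_kernelPoly`.
  refine ⟨((p + q + d - 1 : ℕ) : ℝ) / ((d - 1).factorial : ℝ) / ((d + p + q - 2).factorial : ℝ),
    by positivity, ?_⟩
  have hK : ∑ k, kernelPoly p q (v k : Cd d) ∈ harmonicSpace d p q :=
    Submodule.sum_mem _ fun k _ => kernelPoly_mem_harmonicSpace hd (sum_mul_conj_eq_one _) p q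
  have hne : ((d + p + q - 2).factorial : ℂ) ≠ 0 := by exact_mod_cast Nat.factorial_ne_zero _
  rw [fischer_sum, Finset.mul_sum]
  refine Finset.sum_congr rfl fun j _ => ?_
  rw [fischer_kernelPoly _ hK, map_sum, Finset.mul_sum, Finset.mul_sum]
  refine Finset.sum_congr rfl fun k _ => ?_
  rw [gegenbauer_inner h]
  change _ * eval (doubled (v j : Cd d)) _ = _
  push_cast
  field_simp

lemma sum_gegenbauer_re_nonneg (hd : 1 ≤ d) {i : ℕ × ℕ} (h : i ≠ (0, 0)) (v : Fin n → Sph d) :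
    0 ≤ (∑ j, ∑ k, gegenbauer d i.1 i.2 (inner ℂ (v k : Cd d) (v j : Cd d))).re := by
  obtain ⟨c, hc, e⟩ := sum_gegenbauer_eq hd (p := i.1) (q := i.2) h v
  rw [e, Complex.re_ofReal_mul]
  exact mul_nonneg hc.le (fischer_self_re_nonneg _)

/-- If the norm vanishes, the sum of the kernels is zero, and pairing it with `P` gives a nonzero
multiple of `∑ j, P(v j)`. Conversely, the kernels at the points `v k` themselves belong to
`H(p,q)`. -/
lemma sum_gegenbauer_re_eq_zero_iff (hd : 1 ≤ d) {i : ℕ × ℕ} (h : i ≠ (0, 0))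
    (v : Fin n → Sph d) :
    (∑ j, ∑ k, gegenbauer d i.1 i.2 (inner ℂ (v k : Cd d) (v j : Cd d))).re = 0 ↔
      ∀ P ∈ harmonicSpace d i.1 i.2, ∑ j, evalAt P (v j) = 0 := by
  obtain ⟨c, hc, e⟩ := sum_gegenbauer_eq hd (p := i.1) (q := i.2) h v
  constructor
  · intro h0 P hP
    rw [e, Complex.re_ofReal_mul] at h0
    have hz := eq_zero_of_fischer_self_re ((mul_eq_zero.mp h0).resolve_left hc.ne')
    have hs : ∑ k, fischer (kernelPoly i.1 i.2 (v k : Cd d)) P = 0 := by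
      rw [← fischer_sum, hz, fischer_zero]
    simp_rw [fischer_kernelPoly _ hP] at hs
    rw [← Finset.mul_sum] at hs
    exact (mul_eq_zero.mp hs).resolve_left (by exact_mod_cast Nat.factorial_ne_zero _)
  · intro hP
    rw [Finset.sum_comm, Finset.sum_eq_zero, Complex.zero_re]
    intro k _
    simp_rw [gegenbauer_inner h]
    rw [← Finset.mul_sum,
      hP _ (kernelPoly_mem_harmonicSpace hd (sum_mul_conj_eq_one _) _ _), mul_zero]

lemma evalAt_of_mem_harmonicSpace_zero {P : Poly d} (hP : P ∈ harmonicSpace d 0 0) (z : Sph d) :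
    evalAt P z = coeff 0 P := by
  obtain ⟨h1, h2, -⟩ := mem_harmonicSpace.mp hP
  rw [isWeightedHomogeneous_zero_eq_C h1 h2]
  simp [evalAt]

/-- A sequence is a `τ`-design if and only if the sums of all nonconstant harmonic polynomials
of bidegrees in `τ` over the sequence vanish. -/
lemma isDesign_iff (hd : 1 ≤ d) (hn : 0 < n) (τ : Set (ℕ × ℕ)) (v : Fin n → Sph d) :
    IsDesign τ v ↔ ∀ i ∈ τ, i ≠ (0, 0) →
      ∀ P ∈ harmonicSpace d i.1 i.2, ∑ j, evalAt P (v j) = 0 := by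
  have hn' : (n : ℂ) ≠ 0 := by exact_mod_cast hn.ne'
  have := nontrivial_Cd hd
  have hne : surfaceMeasure d ≠ 0 := Measure.toSphere_ne_zero _
  have : NeZero (surfaceMeasure d) := ⟨hne⟩
  constructor
  · rintro ⟨-, h⟩ i hi hi0 P hP
    have hmem : P ∈ polySpace d τ :=
      (le_iSup₂ (f := fun (i : ℕ × ℕ) (_ : i ∈ τ) => harmonicSpace d i.1 i.2) i hi) hP
    have h2 := h P hmem
    rw [average_eq, integral_evalAt_eq_zero hd hi0 hP, smul_zero, ← Finset.mul_sum] at h2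
    exact (mul_eq_zero.mp h2.symm).resolve_left (inv_ne_zero hn')
  · intro h
    refine ⟨hn, fun P hP => ?_⟩
    -- The polynomials averaged exactly by `v` form a subspace, so it suffices to check each
    -- `H(p,q)`; on the sphere `H(0,0)` gives constants, which any nonempty sequence averages
    -- exactly.
    let V : Submodule ℂ (Poly d) :=
      { carrier := {P | ⨍ x, evalAt P x ∂(surfaceMeasure d) = ∑ j, (n : ℂ)⁻¹ * evalAt P (v j)}
        zero_mem' := by simp [evalAt]
        add_mem' := by
          intro P R hP hR
          simp only [Set.mem_ofPred_eq, average_eq, evalAt_add, mul_add, Finset.sum_add_distrib]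
            at hP hR ⊢
          rw [integral_add (integrable_evalAt P) (integrable_evalAt R), smul_add, hP, hR]
        smul_mem' := by
          intro c P hP
          have hc (z : Sph d) : evalAt (c • P) z = c * evalAt P z := by simp [evalAt, smul_eval]
          simp only [Set.mem_ofPred_eq, average_eq, hc] at hP ⊢
          rw [integral_const_mul, ← mul_smul_comm, hP, Finset.mul_sum]
          exact Finset.sum_congr rfl fun j _ => by ring }
    have hle : polySpace d τ ≤ V := by
      refine iSup₂_le fun i hi P hP => ?_
      change ⨍ x, evalAt P x ∂(surfaceMeasure d) = ∑ j, (n : ℂ)⁻¹ * evalAt P (v j)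
      by_cases hi0 : i = (0, 0)
      · subst hi0
        simp_rw [evalAt_of_mem_harmonicSpace_zero hP]
        rw [average_const]
        simp [hn']
      · rw [average_eq, integral_evalAt_eq_zero hd (p := i.1) (q := i.2) hi0 hP, smul_zero,
          ← Finset.mul_sum, h i hi hi0 P hP, mul_zero]
    exact hle hP

/-- A design condition in terms of Gegenbauer polynomials. -/
lemma isDesign_iff_gegenbauer (hd : 1 ≤ d) (hn : 0 < n) (τ : Set (ℕ × ℕ)) (v : Fin n → Sph d) :
    IsDesign τ v ↔ ∀ i ∈ τ, i ≠ (0, 0) →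
      (∑ j, ∑ k, gegenbauer d i.1 i.2 (inner ℂ (v k : Cd d) (v j : Cd d))).re = 0 := by
  rw [isDesign_iff hd hn]
  exact forall₃_congr fun i _ hi => (sum_gegenbauer_re_eq_zero_iff hd hi v).symm

end Design

/-! ### The energy identity and the two bounds -/

section GegenbauerSum

variable {d n : ℕ}

lemma conj_gegenbauer (p q : ℕ) (z : ℂ) :
    starRingEnd ℂ (gegenbauer d p q z) = gegenbauer d q p z := by
  by_cases h : p = 0 ∧ q = 0
  · simp [gegenbauer, h]
  · rw [gegenbauer, gegenbauer, if_neg h, if_neg (mt And.symm h), min_comm q p, add_comm q p]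
    simp only [map_mul, map_div₀, map_natCast, map_sum, map_pow, map_neg, map_one,
      Complex.conj_conj]
    congr 1
    refine Finset.sum_congr rfl fun j _ => ?_
    rw [add_right_comm d q p]
    ring

lemma conj_gegenbauer_one (p q : ℕ) :
    starRingEnd ℂ (gegenbauer d p q 1) = gegenbauer d p q 1 := by
  unfold gegenbauer
  split_ifs <;> simp

lemma gegenbauerSum_one_im (f : ℕ × ℕ →₀ ℝ) : (gegenbauerSum d f 1).im = 0 := by
  rw [← Complex.conj_eq_iff_im, gegenbauerSum, Finsupp.sum, map_sum]
  refine Finset.sum_congr rfl fun i _ => ?_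
  rw [map_mul, Complex.conj_ofReal, conj_gegenbauer_one]

/-- Conjugation exchanges `Q_pq` and `Q_qp`, so it only permutes the terms of a symmetric sum. -/
lemma gegenbauerSum_im {f : ℕ × ℕ →₀ ℝ} (hf : ∀ p q, f (p, q) = f (q, p)) (z : ℂ) :
    (gegenbauerSum d f z).im = 0 := by
  rw [← Complex.conj_eq_iff_im, gegenbauerSum, Finsupp.sum, map_sum]
  refine Finset.sum_equiv (Equiv.prodComm ℕ ℕ) (fun i => ?_) fun i _ => ?_
  · rw [Equiv.prodComm_apply, Finsupp.mem_support_iff, Finsupp.mem_support_iff,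
      show f i = f i.swap from hf i.1 i.2]
  · rw [map_mul, Complex.conj_ofReal, conj_gegenbauer, Equiv.prodComm_apply, Prod.fst_swap,
      Prod.snd_swap, ← Prod.mk.eta (p := i), hf, Prod.swap_prod_mk]

lemma gegenbauerSum_eq_zero_iff {f : ℕ × ℕ →₀ ℝ} (hf : ∀ p q, f (p, q) = f (q, p)) (z : ℂ) :
    gegenbauerSum d f z = 0 ↔ (gegenbauerSum d f z).re = 0 := by
  simp [Complex.ext_iff, gegenbauerSum_im hf z]

/-- The contribution of the nonconstant terms to the double sum of `F` over a sequence. -/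
noncomputable def energyTail (f : ℕ × ℕ →₀ ℝ) (v : Fin n → Sph d) : ℝ :=
  ∑ i ∈ f.support.erase (0, 0), f i *
    (∑ j, ∑ k, gegenbauer d i.1 i.2 (inner ℂ (v k : Cd d) (v j : Cd d))).re

/-- The sum of `Re F` over the ordered pairs of different indices. -/
noncomputable def offDiagSum (f : ℕ × ℕ →₀ ℝ) (v : Fin n → Sph d) : ℝ :=
  ∑ j, ∑ k ∈ Finset.univ.erase j,
    (gegenbauerSum d f (inner ℂ (v k : Cd d) (v j : Cd d))).re

/-- Both sides are the full double sum of `Re F`, split by index pairs on the left and by the terms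
of `F` on the right. The diagonal consists of equal indices, not equal points, so sequences with
repetitions are covered. -/
lemma add_offDiagSum_eq (f : ℕ × ℕ →₀ ℝ) (v : Fin n → Sph d) :
    n * (gegenbauerSum d f 1).re + offDiagSum f v = f (0, 0) * (n : ℝ) ^ 2 + energyTail f v := by
  have h1 : n * (gegenbauerSum d f 1).re + offDiagSum f v =
      ∑ j, ∑ k, (gegenbauerSum d f (inner ℂ (v k : Cd d) (v j : Cd d))).re := by
    have hj (j : Fin n) : ∑ k, (gegenbauerSum d f (inner ℂ (v k : Cd d) (v j : Cd d))).re =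
        (gegenbauerSum d f 1).re + ∑ k ∈ Finset.univ.erase j,
          (gegenbauerSum d f (inner ℂ (v k : Cd d) (v j : Cd d))).re := by
      rw [← Finset.add_sum_erase _ _ (Finset.mem_univ j), inner_self_eq_norm_sq_to_K]
      simp
    simp_rw [hj]
    rw [Finset.sum_add_distrib]
    simp [offDiagSum]
  have h2 : ∑ j, ∑ k, (gegenbauerSum d f (inner ℂ (v k : Cd d) (v j : Cd d))).re =
      ∑ i ∈ f.support, f i *
        (∑ j, ∑ k, gegenbauer d i.1 i.2 (inner ℂ (v k : Cd d) (v j : Cd d))).re := by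
    simp only [gegenbauerSum, Finsupp.sum, Complex.re_sum, Complex.re_ofReal_mul, Finset.mul_sum]
    rw [Finset.sum_comm (s := f.support)]
    exact Finset.sum_congr rfl fun j _ => Finset.sum_comm
  rw [h1, h2, energyTail]
  by_cases h0 : ((0, 0) : ℕ × ℕ) ∈ f.support
  · rw [← Finset.add_sum_erase _ _ h0]
    congr 1
    simp [gegenbauer, sq]
  · rw [Finset.erase_eq_of_notMem h0, Finsupp.notMem_support_iff.mp h0, zero_mul, zero_add]

lemma forall_angles_iff {v : Fin n → Sph d} (hv : Function.Injective v) (p : ℂ → Prop) :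
    (∀ α ∈ angles v, p α) ↔ ∀ j, ∀ k ∈ Finset.univ.erase j,
      p (inner ℂ (v k : Cd d) (v j : Cd d)) := by
  constructor
  · intro h j k hk
    exact h _ ⟨j, k, hv.ne (Finset.ne_of_mem_erase hk).symm, rfl⟩
  · rintro h α ⟨j, k, hjk, rfl⟩
    exact h j k (Finset.mem_erase.mpr ⟨fun e => hjk (by rw [e]), Finset.mem_univ _⟩)

lemma offDiagSum_eq_zero_iff_of_nonneg {f : ℕ × ℕ →₀ ℝ} {v : Fin n → Sph d}
    (hv : Function.Injective v) (h : ∀ α ∈ angles v, 0 ≤ (gegenbauerSum d f α).re) :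
    offDiagSum f v = 0 ↔ ∀ α ∈ angles v, (gegenbauerSum d f α).re = 0 := by
  rw [forall_angles_iff hv] at h ⊢
  rw [offDiagSum, Finset.sum_eq_zero_iff_of_nonneg fun j _ => Finset.sum_nonneg (h j)]
  refine ⟨fun H j => ?_, fun H j _ => Finset.sum_eq_zero (H j)⟩
  exact (Finset.sum_eq_zero_iff_of_nonneg (h j)).mp (H j (Finset.mem_univ j))

lemma offDiagSum_eq_zero_iff_of_nonpos {f : ℕ × ℕ →₀ ℝ} {v : Fin n → Sph d}
    (hv : Function.Injective v) (h : ∀ α ∈ angles v, (gegenbauerSum d f α).re ≤ 0) :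
    offDiagSum f v = 0 ↔ ∀ α ∈ angles v, (gegenbauerSum d f α).re = 0 := by
  rw [forall_angles_iff hv] at h ⊢
  rw [offDiagSum, Finset.sum_eq_zero_iff_of_nonpos fun j _ => Finset.sum_nonpos (h j)]
  refine ⟨fun H j => ?_, fun H j _ => Finset.sum_eq_zero (H j)⟩
  exact (Finset.sum_eq_zero_iff_of_nonpos (h j)).mp (H j (Finset.mem_univ j))

lemma energyTail_term_nonneg (hd : 1 ≤ d) {f : ℕ × ℕ →₀ ℝ} (hf : negIndices f = ∅)
    (v : Fin n → Sph d) : ∀ i ∈ f.support.erase (0, 0), 0 ≤ f i *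
      (∑ j, ∑ k, gegenbauer d i.1 i.2 (inner ℂ (v k : Cd d) (v j : Cd d))).re := by
  intro i hi
  have : ¬ f i < 0 := fun h => Set.eq_empty_iff_forall_notMem.mp hf i h
  exact mul_nonneg (not_lt.mp this) (sum_gegenbauer_re_nonneg hd (Finset.ne_of_mem_erase hi) v)

lemma energyTail_nonneg (hd : 1 ≤ d) {f : ℕ × ℕ →₀ ℝ} (hf : negIndices f = ∅)
    (v : Fin n → Sph d) : 0 ≤ energyTail f v :=
  Finset.sum_nonneg (energyTail_term_nonneg hd hf v)

lemma energyTail_eq_zero_iff_of_neg_empty (hd : 1 ≤ d) (hn : 0 < n) {f : ℕ × ℕ →₀ ℝ}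
    (hf : negIndices f = ∅) (v : Fin n → Sph d) :
    energyTail f v = 0 ↔ IsDesign (posIndices f) v := by
  rw [isDesign_iff_gegenbauer hd hn, energyTail,
    Finset.sum_eq_zero_iff_of_nonneg (energyTail_term_nonneg hd hf v)]
  constructor
  · intro H i hi hi0
    have hi' : 0 < f i := hi
    exact (mul_eq_zero.mp (H i (Finset.mem_erase.mpr
      ⟨hi0, Finsupp.mem_support_iff.mpr hi'.ne'⟩))).resolve_left hi'.ne'
  · intro H i hi
    obtain ⟨hi0, hi⟩ := Finset.mem_erase.mp hi
    have h1 : ¬ f i < 0 := fun h => Set.eq_empty_iff_forall_notMem.mp hf i h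
    have h2 : 0 < f i := lt_of_le_of_ne (not_lt.mp h1) (Finsupp.mem_support_iff.mp hi).symm
    rw [H i h2 hi0, mul_zero]

/-- The design property removes the terms with positive coefficient; the others are a nonpositive
coefficient times a nonnegative double sum. -/
lemma energyTail_term_nonpos (hd : 1 ≤ d) {f : ℕ × ℕ →₀ ℝ} {v : Fin n → Sph d}
    (hv : IsDesign (posIndices f) v) : ∀ i ∈ f.support.erase (0, 0), f i *
      (∑ j, ∑ k, gegenbauer d i.1 i.2 (inner ℂ (v k : Cd d) (v j : Cd d))).re ≤ 0 := by
  intro i hi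
  have hi0 := Finset.ne_of_mem_erase hi
  rcases lt_or_ge 0 (f i) with h | h
  · rw [(isDesign_iff_gegenbauer hd hv.1 _ v).mp hv i h hi0, mul_zero]
  · exact mul_nonpos_of_nonpos_of_nonneg h (sum_gegenbauer_re_nonneg hd hi0 v)

lemma energyTail_nonpos (hd : 1 ≤ d) {f : ℕ × ℕ →₀ ℝ} {v : Fin n → Sph d}
    (hv : IsDesign (posIndices f) v) : energyTail f v ≤ 0 :=
  Finset.sum_nonpos (energyTail_term_nonpos hd hv)

lemma energyTail_eq_zero_iff_of_isDesign (hd : 1 ≤ d) {f : ℕ × ℕ →₀ ℝ} {v : Fin n → Sph d}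
    (hv : IsDesign (posIndices f) v) :
    energyTail f v = 0 ↔ IsDesign (negIndices f) v := by
  rw [isDesign_iff_gegenbauer hd hv.1, energyTail,
    Finset.sum_eq_zero_iff_of_nonpos (energyTail_term_nonpos hd hv)]
  constructor
  · intro H i hi hi0
    have hi' : f i < 0 := hi
    exact (mul_eq_zero.mp (H i (Finset.mem_erase.mpr
      ⟨hi0, Finsupp.mem_support_iff.mpr hi'.ne⟩))).resolve_left hi'.ne
  · intro H i hi
    obtain ⟨hi0, hi⟩ := Finset.mem_erase.mp hi
    rcases lt_or_gt_of_ne (Finsupp.mem_support_iff.mp hi) with h | h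
    · rw [H i h hi0, mul_zero]
    · rw [(isDesign_iff_gegenbauer hd hv.1 _ v).mp hv i h hi0, mul_zero]

/-- The energy identity for a single point has no off-diagonal part, so `F(1) = f_00 + E` with `E ≥
0`. This is needed for the empty code. -/
lemma gegenbauerSum_one_pos (hd : 1 ≤ d) {f : ℕ × ℕ →₀ ℝ} (hf : 0 < f (0, 0))
    (hneg : negIndices f = ∅) : 0 < (gegenbauerSum d f 1).re := by
  have := nontrivial_Cd hd
  obtain ⟨x, hx⟩ := (NormedSpace.sphere_nonempty (E := Cd d) (x := 0) (r := 1)).mpr zero_le_one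
  have h := add_offDiagSum_eq f (fun _ : Fin 1 => (⟨x, hx⟩ : Sph d))
  have h2 := energyTail_nonneg hd hneg (fun _ : Fin 1 => (⟨x, hx⟩ : Sph d))
  have h3 : offDiagSum f (fun _ : Fin 1 => (⟨x, hx⟩ : Sph d)) = 0 := by
    simp [offDiagSum]
  rw [h3] at h
  norm_num at h
  linarith

lemma forall_angles_eq_zero_iff {f : ℕ × ℕ →₀ ℝ} (hf : ∀ p q, f (p, q) = f (q, p))
    (v : Fin n → Sph d) : (∀ α ∈ angles v, gegenbauerSum d f α = 0) ↔
      ∀ α ∈ angles v, (gegenbauerSum d f α).re = 0 :=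
  forall₂_congr fun α _ => gegenbauerSum_eq_zero_iff hf α

/-- The upper bound for codes. -/
lemma card_le_and_eq_iff_of_isCode (hd : 1 ≤ d) {f : ℕ × ℕ →₀ ℝ} (hf : 0 < f (0, 0))
    (hneg : negIndices f = ∅) {A : Set ℂ} (hA : ∀ α ∈ A, (gegenbauerSum d f α).re ≤ 0)
    {v : Fin n → Sph d} (hv : IsCode A v) :
    (n : ℝ) ≤ (gegenbauerSum d f 1).re / f (0, 0) ∧
      ((n : ℝ) = (gegenbauerSum d f 1).re / f (0, 0) ↔
        (∀ α ∈ angles v, (gegenbauerSum d f α).re = 0) ∧ IsDesign (posIndices f) v) := by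
  have hpos := gegenbauerSum_one_pos hd hf hneg
  -- For the empty code both sides of the criterion are false: the bound is strict, and a design has
  -- `n > 0`.
  rcases Nat.eq_zero_or_pos n with rfl | hn
  · have : 0 < (gegenbauerSum d f 1).re / f (0, 0) := div_pos hpos hf
    refine ⟨by simpa using this.le, fun h => absurd h ?_, fun h => absurd h.2.1 (lt_irrefl 0)⟩
    simpa using this.ne
  have hn' : (0 : ℝ) < n := by exact_mod_cast hn
  have hle : ∀ α ∈ angles v, (gegenbauerSum d f α).re ≤ 0 := fun α hα => hA α (hv.2 hα)
  have hD : offDiagSum f v ≤ 0 :=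
    Finset.sum_nonpos fun j _ => Finset.sum_nonpos ((forall_angles_iff hv.1 _).mp hle j)
  have hE := energyTail_nonneg hd hneg v
  have h := add_offDiagSum_eq f v
  rw [← offDiagSum_eq_zero_iff_of_nonpos hv.1 hle, ← energyTail_eq_zero_iff_of_neg_empty hd hn hneg,
    le_div_iff₀ hf, eq_div_iff hf.ne']
  -- Here `n (F(1) - f_00 n) = E - D` with `D ≤ 0 ≤ E`, so equality forces both to vanish.
  refine ⟨le_of_mul_le_mul_left (by linarith) hn', fun he => ?_, fun he => ?_⟩
  · rw [← he] at h
    constructor <;> linarith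
  · rw [he.1, he.2] at h
    exact mul_left_cancel₀ hn'.ne' (by linarith)

/-- The lower bound for designs. -/
lemma le_card_and_eq_iff_of_isDesign (hd : 1 ≤ d) {f : ℕ × ℕ →₀ ℝ} (hf : 0 < f (0, 0))
    (hF : ∀ α : ℂ, ‖α‖ ≤ 1 → 0 ≤ (gegenbauerSum d f α).re)
    {v : Fin n → Sph d} (hv : IsDesign (posIndices f) v) :
    (gegenbauerSum d f 1).re / f (0, 0) ≤ (n : ℝ) ∧
      (Function.Injective v → ((n : ℝ) = (gegenbauerSum d f 1).re / f (0, 0) ↔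
        (∀ α ∈ angles v, (gegenbauerSum d f α).re = 0) ∧ IsDesign (negIndices f) v)) := by
  have hn' : (0 : ℝ) < n := by exact_mod_cast hv.1
  -- By Cauchy–Schwarz every inner product lies in the closed unit disk, including the value `1` at
  -- repeated points.
  have hin (j k : Fin n) :
      0 ≤ (gegenbauerSum d f (inner ℂ (v k : Cd d) (v j : Cd d))).re :=
    hF _ ((norm_inner_le_norm _ _).trans (by simp))
  have hD : 0 ≤ offDiagSum f v :=
    Finset.sum_nonneg fun j _ => Finset.sum_nonneg fun k _ => hin j k
  have hE := energyTail_nonpos hd hv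
  have h := add_offDiagSum_eq f v
  rw [div_le_iff₀ hf]
  -- The signs are now reversed: `E ≤ 0 ≤ D`.
  refine ⟨le_of_mul_le_mul_left (by linarith) hn', fun hinj => ?_⟩
  rw [← offDiagSum_eq_zero_iff_of_nonneg hinj
      ((forall_angles_iff hinj _).mpr fun j k _ => hin j k),
    ← energyTail_eq_zero_iff_of_isDesign hd hv, eq_div_iff hf.ne']
  refine ⟨fun he => ?_, fun he => ?_⟩
  · rw [← he] at h
    constructor <;> linarith
  · rw [he.1, he.2] at h
    exact mul_left_cancel₀ hn'.ne' (by linarith)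

end GegenbauerSum

end ComplexDesign

open ComplexDesign in
theorem mainTheorem8 (d : ℕ) (hd : 1 ≤ d) (f : ℕ × ℕ →₀ ℝ) (hf : 0 < f (0, 0))
    (A : Set ℂ) (hA : A ⊆ {z : ℂ | ‖z‖ ≤ 1 ∧ z ≠ 1}) :
    -- `F(1)` is a real number
    (gegenbauerSum d f 1).im = 0 ∧
    -- (i) the upper bound for codes
    (negIndices f = ∅ → (∀ α ∈ A, (gegenbauerSum d f α).re ≤ 0) →
      ∀ (n : ℕ) (v : Fin n → Sph d), IsCode A v →
        (n : ℝ) ≤ (gegenbauerSum d f 1).re / f (0, 0) ∧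
        ((n : ℝ) = (gegenbauerSum d f 1).re / f (0, 0) ↔
          (∀ α ∈ angles v, (gegenbauerSum d f α).re = 0) ∧ IsDesign (posIndices f) v) ∧
        ((∀ p q, f (p, q) = f (q, p)) →
          ((n : ℝ) = (gegenbauerSum d f 1).re / f (0, 0) ↔
            (∀ α ∈ angles v, gegenbauerSum d f α = 0) ∧ IsDesign (posIndices f) v))) ∧
    -- (ii) the lower bound for designs
    ((∀ α : ℂ, ‖α‖ ≤ 1 → 0 ≤ (gegenbauerSum d f α).re) →
      ∀ (n : ℕ) (v : Fin n → Sph d), IsDesign (posIndices f) v →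
        (gegenbauerSum d f 1).re / f (0, 0) ≤ (n : ℝ) ∧
        (Function.Injective v →
          ((n : ℝ) = (gegenbauerSum d f 1).re / f (0, 0) ↔
            (∀ α ∈ angles v, (gegenbauerSum d f α).re = 0) ∧ IsDesign (negIndices f) v) ∧
          ((∀ p q, f (p, q) = f (q, p)) →
            ((n : ℝ) = (gegenbauerSum d f 1).re / f (0, 0) ↔
              (∀ α ∈ angles v, gegenbauerSum d f α = 0) ∧ IsDesign (negIndices f) v)))) := by

  refine ⟨gegenbauerSum_one_im f, fun hneg hre n v hv => ?_, fun hF n v hv => ?_⟩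
  · obtain ⟨h1, h2⟩ := card_le_and_eq_iff_of_isCode hd hf hneg hre hv
    exact ⟨h1, h2, fun hs => by rw [forall_angles_eq_zero_iff hs]; exact h2⟩
  · obtain ⟨h1, h2⟩ := le_card_and_eq_iff_of_isDesign hd hf hF hv
    exact ⟨h1, fun hi => ⟨h2 hi, fun hs => by rw [forall_angles_eq_zero_iff hs]; exact h2 hi⟩⟩
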